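/- Let $K$ be a field, let $S=K[x_1,\dots,x_n]$, and let $I\subseteq S$ be a monomial ideal whose minimal monomial generators $f_1,\dots,f_m$ all have the same degree $d$. For $1\le i\le n$ let $M_i$ be the highest exponent with which $x_i$ occurs in $f_1,\dots,f_m$, and let $M=\max_i M_i$ (a maximum over the empty set being $0$). In the polynomial ring $R=K[x_1,\dots,x_n,y_1,\dots,y_m]$, with all variables of degree $1$, consider the ideals $$\mathrm{Lin}(I)=\big(x_1^{a_1}\cdots x_n^{a_n}\mid a_1+\dots+a_n=d,\ a_i\le M_i\text{ for all }i\big)+L,$$ $$\mathrm{LIN}(I)=\big(x_1^{a_1}\cdots x_n^{a_n}\mid a_1+\dots+a_n=d,\ a_i\le M\text{ for all }i\big)+L,$$ where $$L=\Big(\frac{f_j}{x_k}\,y_j\;\Big|\;1\le j\le m,\ 1\le k\le n,\ x_k\text{ divides }f_j\Big).$$ Then both $\mathrm{Lin}(I)$ and $\mathrm{LIN}(I)$ have a $d$-linear resolution over $R$: each of them has a minimal graded free resolution $\cdots\to F_2\to F_1\to F_0\to J\to 0$ (where $J$ is the ideal in question) with $F_i=\bigoplus_{j\in\mathbb Z}R(-j)^{\beta_{i,j}}$,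 all $\beta_{i,j}$ finite, such that $\beta_{i,j}=0$ whenever $j\ne i+d$. -/

import Mathlib

open MvPolynomial

/-- `f` is homogeneous of (integer) degree `z` for the standard grading; if `z < 0` this forces
`f = 0`. -/
def IsHomogeneousOfDegree {σ K : Type*} [CommSemiring K] (f : MvPolynomial σ K) (z : ℤ) : Prop :=
  ∀ m ∈ f.support, (m.degree : ℤ) = z

/-- The homogeneous elements of degree `k` in the graded free module `⨁ b, R(-s b)`. -/
def IsShiftedHomogeneous {σ K B : Type*} [CommSemiring K] (s : B → ℤ)
    (v : B → MvPolynomial σ K) (k : ℤ) : Prop :=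
  ∀ b, IsHomogeneousOfDegree (v b) (k - s b)

/-- A minimal graded free resolution `⋯ → F₂ → F₁ → F₀ → I → 0` of an ideal `I` of the polynomial
ring `R = K[σ]`. The `i`-th module is `F i = ⨁_{b : basis i} R(-shift i b)`, of finite rank. -/
structure MinimalGradedFreeResolution {σ K : Type*} [Field K] (I : Ideal (MvPolynomial σ K)) where
  basis : ℕ → Type
  [fintypeBasis : ∀ i, Fintype (basis i)]
  shift : ∀ i, basis i → ℤ
  /-- `d i` is the differential `F (i + 1) → F i`. -/
  d : ∀ i, (basis (i + 1) → MvPolynomial σ K) →ₗ[MvPolynomial σ K] (basis i → MvPolynomial σ K)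
  /-- The augmentation `F 0 → I`. -/
  ε : (basis 0 → MvPolynomial σ K) →ₗ[MvPolynomial σ K] I
  ε_surjective : Function.Surjective ε
  exact_zero : Function.Exact (d 0) ε
  exact_succ : ∀ i, Function.Exact (d (i + 1)) (d i)
  ε_graded : ∀ v k, IsShiftedHomogeneous (shift 0) v k →
    IsHomogeneousOfDegree (ε v : MvPolynomial σ K) k
  d_graded : ∀ i v k, IsShiftedHomogeneous (shift (i + 1)) v k →
    IsShiftedHomogeneous (shift i) (d i v) k
  minimal : ∀ i, LinearMap.range (d i) ≤
    idealOfVars σ K • (⊤ : Submodule (MvPolynomial σ K) (basis i → MvPolynomial σ K))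

/-- The graded Betti number `β_{i,j}`: the number of summands `R(-j)` in the `i`-th module. -/
noncomputable def MinimalGradedFreeResolution.betti {σ K : Type*} [Field K]
    {I : Ideal (MvPolynomial σ K)} (F : MinimalGradedFreeResolution I) (i : ℕ) (j : ℤ) : ℕ :=
  Nat.card {b : F.basis i // F.shift i b = j}

/-- `I` has a `d`-linear resolution: its minimal graded free resolution satisfies `β_{i,j} = 0`
for all `j ≠ i + d`. -/
def HasLinearResolution {σ K : Type*} [Field K] (I : Ideal (MvPolynomial σ K)) (d : ℕ) : Prop :=
  ∃ F : MinimalGradedFreeResolution I, ∀ (i : ℕ) (j : ℤ), j ≠ i + d → F.betti i j = 0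

/-- An ideal is monomial if it is generated by monomials. -/
def IsMonomialIdeal {σ K : Type*} [Field K] (I : Ideal (MvPolynomial σ K)) : Prop :=
  ∃ s : Set (σ →₀ ℕ), I = Ideal.span ((fun a => monomial a (1 : K)) '' s)

/-- The exponent vectors of the minimal monomial generators `G(I)`: the monomials in `I` that are
minimal with respect to divisibility. -/
def minGens {σ K : Type*} [Field K] (I : Ideal (MvPolynomial σ K)) : Set (σ →₀ ℕ) :=
  {a | Minimal (fun b => monomial b (1 : K) ∈ I) a}

/-- All minimal monomial generators have degree `d`. -/
def IsEquigenerated {σ K : Type*} [Field K] (I : Ideal (MvPolynomial σ K)) (d : ℕ) : Prop :=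
  ∀ f ∈ minGens I, f.degree = d

/-- `M_i`: the highest exponent with which `x_i` occurs in `G(I)` (`0` if `G(I)` is empty). -/
noncomputable def maxExp {n : ℕ} {K : Type*} [Field K] (I : Ideal (MvPolynomial (Fin n) K))
    (i : Fin n) : ℕ :=
  ⨆ f : minGens I, f.1 i

/-- `M`: the highest exponent occurring in `G(I)`. -/
noncomputable def maxExpAll {n : ℕ} {K : Type*} [Field K]
    (I : Ideal (MvPolynomial (Fin n) K)) : ℕ :=
  ⨆ i : Fin n, maxExp I i

/-- The ring `K[x_1, …, x_n, y_1, …, y_m]`, with one variable `y_f` for each `f ∈ G(I)`. -/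
abbrev LinRing {n : ℕ} {K : Type*} [Field K] (I : Ideal (MvPolynomial (Fin n) K)) : Type _ :=
  MvPolynomial (Fin n ⊕ minGens I) K

/-- The ideal generated by the monomials of degree `d` in the `x`-variables in which the exponent
of `x_i` is at most `v i` for all `i`. -/
noncomputable def completePart {n : ℕ} {K : Type*} [Field K] (I : Ideal (MvPolynomial (Fin n) K))
    (d : ℕ) (v : Fin n → ℕ) : Ideal (LinRing I) :=
  Ideal.span {p | ∃ a : Fin n →₀ ℕ, a.degree = d ∧ (∀ i, a i ≤ v i) ∧
    p = rename Sum.inl (monomial a (1 : K))}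

/-- The ideal generated by the monomials `(f / x_k) y_f` with `f ∈ G(I)` and `x_k ∣ f`. -/
noncomputable def lastPart {n : ℕ} {K : Type*} [Field K] (I : Ideal (MvPolynomial (Fin n) K)) :
    Ideal (LinRing I) :=
  Ideal.span {p | ∃ (f : minGens I) (k : Fin n), f.1 k ≠ 0 ∧
    p = rename Sum.inl (monomial (f.1 - Finsupp.single k 1) (1 : K)) * X (Sum.inr f)}

/-- The linearization `Lin(I)` of a monomial ideal `I` equigenerated in degree `d`. -/
noncomputable def Lin {n : ℕ} {K : Type*} [Field K] (I : Ideal (MvPolynomial (Fin n) K))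
    (d : ℕ) : Ideal (LinRing I) :=
  completePart I d (maxExp I) ⊔ lastPart I

/-- The `*`-linearization `LIN(I)` of a monomial ideal `I` equigenerated in degree `d`. -/
noncomputable def LINStar {n : ℕ} {K : Type*} [Field K] (I : Ideal (MvPolynomial (Fin n) K))
    (d : ℕ) : Ideal (LinRing I) :=
  completePart I d (fun _ => maxExpAll I) ⊔ lastPart I

/-! Both ideals have linear quotients: their generators, all of degree d, can be ordered so that
each colon ideal of the earlier generators by the next one is generated by variables.

Linear quotients give a linear resolution because the property passes to syzygies. A variable z in
the colon ideal of `u b` yields a linear syzygy with last nonzero entry z, in position b. These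
syzygies generate the kernel (`ker_toMap`), and in lexicographic order of the pairs (b, z) they
again have linear quotients (`smul_syzygies_mem_iff`). Iteration gives a resolution whose
differentials have linear entries, hence a minimal and linear one.

For the linearization, the bounded monomials in x come first, in decreasing lexicographic order,
then the monomials (f/x_k) y_f in any order. The first block is handled by an exchange
(`exists_lex_exchange`). In the second, f/x_k has degree d - 1, so one suitable x_i raises it to a
monomial of the first block; when two quotients f/x_k and g/x_l coincide, the variable y_f serves
instead. Only the bound M_i ≤ v_i is needed, so both choices of bounds are covered. -/

/-- Multiplication by a form of degree `e` shifts homogeneous components by `e`. -/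
theorem homogeneousComponent_mul_of_isHomogeneous {σ K : Type*} [CommSemiring K]
    {q : MvPolynomial σ K} {e : ℕ} (hq : q.IsHomogeneous e) (k : ℕ) (p : MvPolynomial σ K) :
    homogeneousComponent (k + e) (p * q) = homogeneousComponent k p * q := by
  conv_lhs => rw [← sum_homogeneousComponent p, Finset.sum_mul, map_sum]
  have h : ∀ i, homogeneousComponent (k + e) (homogeneousComponent i p * q) =
      if i = k then homogeneousComponent k p * q else 0 := by
    intro i
    rw [homogeneousComponent_of_mem
      (((mem_homogeneousSubmodule _ _).2 ((homogeneousComponent_isHomogeneous i p).mul hq)))]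
    by_cases hik : i = k
    · subst hik; simp
    · rw [if_neg (by omega), if_neg hik]
  simp only [h, Finset.sum_ite_eq', Finset.mem_range]
  split_ifs with hk
  · rfl
  · rw [homogeneousComponent_eq_zero _ _ (by omega), zero_mul]

/-- A nonzero function on a finite linear order has a last index where it does not vanish. -/
theorem exists_last_ne_zero {ι M : Type*} [Finite ι] [LinearOrder ι] [Zero M] {v : ι → M}
    (hv : v ≠ 0) : ∃ m, v m ≠ 0 ∧ ∀ i, m < i → v i = 0 := by
  obtain ⟨m, hm⟩ := (Set.toFinite (Function.support v)).exists_maximal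
    (Function.support_nonempty_iff.2 hv)
  refine ⟨m, hm.1, fun i hi => ?_⟩
  by_contra h
  exact absurd (hm.2 h hi.le) (not_le.2 hi)

/-! ### Linear quotients and their syzygies -/

/-- A finite, linearly ordered family of vectors `u b` in a free module over `K[σ]`, all homogeneous
of the same degree, with linear quotients: each colon ideal `(u c | c < b) : u b` is generated by
a set `vars b` of variables. -/
structure LinearQuotients (σ : Type) (K : Type*) [Field K] where
  coord : Type
  index : Type
  [fintypeIndex : Fintype index]
  [linearOrderIndex : LinearOrder index]
  u : index → coord → MvPolynomial σ K
  deg : ℕ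
  isHomogeneous : ∀ b a, (u b a).IsHomogeneous deg
  vars : index → Set σ
  colon : ∀ b (g : MvPolynomial σ K), g • u b ∈ Submodule.span (MvPolynomial σ K) (u '' Set.Iio b) ↔
    g ∈ Ideal.span (X '' vars b)

namespace LinearQuotients

variable {σ : Type} {K : Type*} [Field K] (S : LinearQuotients σ K)

attribute [instance] fintypeIndex linearOrderIndex

/-- The map from the free module on the index set that sends the basis to the family. -/
noncomputable def toMap : (S.index → MvPolynomial σ K) →ₗ[MvPolynomial σ K]
    (S.coord → MvPolynomial σ K) :=
  Fintype.linearCombination (MvPolynomial σ K) S.u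

theorem toMap_apply (v : S.index → MvPolynomial σ K) : S.toMap v = ∑ b, v b • S.u b :=
  Fintype.linearCombination_apply _ _ _

/-- Since `X z • u b` is homogeneous of degree `1 + deg`, any expression of it by earlier elements
remains valid when each coefficient is replaced by its component of degree 1. -/
theorem exists_linear_relation (b : S.index) (z : σ) (hz : z ∈ S.vars b) :
    ∃ c : S.index → MvPolynomial σ K, (∀ i, (c i).IsHomogeneous 1) ∧ (∀ i, b ≤ i → c i = 0) ∧
      S.toMap c = (X z : MvPolynomial σ K) • S.u b := by
  have h := (S.colon b (X z)).2 (Ideal.subset_span ⟨z, hz, rfl⟩)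
  rw [Finsupp.mem_span_image_iff_linearCombination] at h
  obtain ⟨l, hl, hlu⟩ := h
  refine ⟨fun i => homogeneousComponent 1 (l i), fun i => homogeneousComponent_isHomogeneous _ _,
    fun i hi => ?_, ?_⟩
  · have : l i = 0 := by
      by_contra h0
      exact absurd (hl (Finsupp.mem_support_iff.2 h0)) (not_lt.2 hi)
    simp [this]
  · funext a
    rw [toMap_apply, Finset.sum_apply]
    have hla := congrArg (fun w => homogeneousComponent (1 + S.deg) (w a)) hlu
    rw [Finsupp.linearCombination_apply, Finsupp.sum_fintype _ _ (by simp)] at hla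
    simp only [Finset.sum_apply, Pi.smul_apply, smul_eq_mul, map_sum,
      homogeneousComponent_mul_of_isHomogeneous (S.isHomogeneous _ a)] at hla ⊢
    rw [hla, homogeneousComponent_eq_self (isHomogeneous_X K z)]

/-- The coefficients, linear forms, that express `X z • u b` by the earlier elements. -/
noncomputable def relation (b : S.index) (z : σ) (hz : z ∈ S.vars b) :
    S.index → MvPolynomial σ K :=
  (S.exists_linear_relation b z hz).choose

theorem relation_isHomogeneous (b : S.index) (z : σ) (hz : z ∈ S.vars b) (i : S.index) :
    (S.relation b z hz i).IsHomogeneous 1 :=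
  (S.exists_linear_relation b z hz).choose_spec.1 i

theorem relation_eq_zero (b : S.index) (z : σ) (hz : z ∈ S.vars b) (i : S.index) (hi : b ≤ i) :
    S.relation b z hz i = 0 :=
  (S.exists_linear_relation b z hz).choose_spec.2.1 i hi

theorem toMap_relation (b : S.index) (z : σ) (hz : z ∈ S.vars b) :
    S.toMap (S.relation b z hz) = (X z : MvPolynomial σ K) • S.u b :=
  (S.exists_linear_relation b z hz).choose_spec.2.2

/-- The linear syzygy attached to a variable in the colon ideal of `u b`. -/
noncomputable def syzygy (b : S.index) (z : σ) (hz : z ∈ S.vars b) :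
    S.index → MvPolynomial σ K :=
  Pi.single b (X z) - S.relation b z hz

theorem toMap_syzygy (b : S.index) (z : σ) (hz : z ∈ S.vars b) :
    S.toMap (S.syzygy b z hz) = 0 := by
  rw [syzygy, map_sub, toMap_relation, sub_eq_zero]
  exact Fintype.linearCombination_apply_single _ _ _ _

theorem syzygy_self (b : S.index) (z : σ) (hz : z ∈ S.vars b) : S.syzygy b z hz b = X z := by
  simp [syzygy, S.relation_eq_zero b z hz b le_rfl]

theorem syzygy_of_lt (b : S.index) (z : σ) (hz : z ∈ S.vars b) (i : S.index) (hi : b < i) :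
    S.syzygy b z hz i = 0 := by
  simp [syzygy, S.relation_eq_zero b z hz i hi.le, Pi.single_eq_of_ne hi.ne']

theorem syzygy_isHomogeneous (b : S.index) (z : σ) (hz : z ∈ S.vars b) (i : S.index) :
    (S.syzygy b z hz i).IsHomogeneous 1 := by
  refine IsHomogeneous.sub ?_ (S.relation_isHomogeneous b z hz i)
  by_cases h : i = b
  · subst h; simpa using isHomogeneous_X K z
  · simpa [Pi.single_eq_of_ne h] using isHomogeneous_zero σ K 1

/-- The pairs of an index and a variable in its colon ideal, ordered lexicographically. -/
abbrev SyzygyIndex [LinearOrder σ] : Type :=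
  {p : S.index ×ₗ σ // (ofLex p).2 ∈ S.vars (ofLex p).1}

variable [LinearOrder σ]

/-- The family of all linear syzygies. -/
noncomputable def syzygies (p : S.SyzygyIndex) : S.index → MvPolynomial σ K :=
  S.syzygy (ofLex p.1).1 (ofLex p.1).2 p.2

/-- Last coefficients of combinations of the linear syzygies fill the whole colon ideal; this allows
the last coefficient of any syzygy to be cancelled. -/
theorem exists_mem_span_syzygies (j : S.index) (g : MvPolynomial σ K)
    (hg : g ∈ Ideal.span (X '' S.vars j)) :
    ∃ t ∈ Submodule.span (MvPolynomial σ K) (S.syzygies '' {p | (ofLex p.1).1 ≤ j}),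
      S.toMap t = 0 ∧ t j = g ∧ ∀ i, j < i → t i = 0 := by
  induction hg using Submodule.span_induction with
  | mem x hx =>
    obtain ⟨z, hz, rfl⟩ := hx
    exact ⟨S.syzygy j z hz, Submodule.subset_span ⟨⟨toLex (j, z), hz⟩, le_rfl, rfl⟩,
      S.toMap_syzygy j z hz, S.syzygy_self j z hz, S.syzygy_of_lt j z hz⟩
  | zero => exact ⟨0, zero_mem _, map_zero _, rfl, fun _ _ => rfl⟩
  | add x y _ _ hx hy =>
    obtain ⟨s, hs, hs0, rfl, hs'⟩ := hx
    obtain ⟨t, ht, ht0, rfl, ht'⟩ := hy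
    exact ⟨s + t, add_mem hs ht, by rw [map_add, hs0, ht0, add_zero], rfl,
      fun i hi => by simp [hs' i hi, ht' i hi]⟩
  | smul a x _ hx =>
    obtain ⟨s, hs, hs0, rfl, hs'⟩ := hx
    exact ⟨a • s, Submodule.smul_mem _ a hs, by rw [map_smul, hs0, smul_zero], rfl,
      fun i hi => by simp [hs' i hi]⟩

/-- Induction on the last position: there the coefficient of a syzygy lies in the colon ideal, so
subtracting a combination of linear syzygies moves the support strictly down. -/
theorem mem_span_syzygies_of_le (j : S.index) : ∀ v, S.toMap v = 0 → (∀ i, j < i → v i = 0) →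
    v ∈ Submodule.span (MvPolynomial σ K) (S.syzygies '' {p | (ofLex p.1).1 ≤ j}) := by
  induction j using WellFoundedLT.induction with
  | ind j ih =>
    intro v hv hvj
    have hcolon : v j ∈ Ideal.span (X '' S.vars j) := by
      rw [← S.colon j]
      rw [toMap_apply, ← Finset.add_sum_erase _ _ (Finset.mem_univ j)] at hv
      rw [eq_neg_of_add_eq_zero_left hv]
      refine neg_mem (sum_mem fun i hi => ?_)
      rcases lt_or_gt_of_ne (Finset.ne_of_mem_erase hi) with h | h
      · exact Submodule.smul_mem _ _ (Submodule.subset_span ⟨i, h, rfl⟩)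
      · rw [hvj i h, zero_smul]; exact zero_mem _
    obtain ⟨t, ht, ht0, htj, hti⟩ := S.exists_mem_span_syzygies j _ hcolon
    suffices h : v - t ∈ Submodule.span (MvPolynomial σ K)
        (S.syzygies '' {p | (ofLex p.1).1 ≤ j}) by
      simpa using add_mem h ht
    have hvt : ∀ i, j ≤ i → (v - t) i = 0 := by
      intro i hi
      rcases hi.eq_or_lt with rfl | hi
      · simp [htj]
      · simp [hvj i hi, hti i hi]
    by_cases h0 : v - t = 0
    · rw [h0]; exact zero_mem _
    · obtain ⟨m, hm, hmi⟩ := exists_last_ne_zero h0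
      have hmj : m < j := by
        by_contra h
        exact hm (hvt m (not_lt.1 h))
      exact Submodule.span_mono (Set.image_mono fun p hp => le_trans hp hmj.le)
        (ih m hmj (v - t) (by rw [map_sub, hv, ht0, sub_zero]) hmi)

/-- Generation of the kernel alone would not suffice for the colon ideals of the syzygies: there it
matters that only positions up to the last one in the support of v occur. -/
theorem mem_span_syzygies (v : S.index → MvPolynomial σ K) (hv : S.toMap v = 0) :
    v ∈ Submodule.span (MvPolynomial σ K)
      (S.syzygies '' {p | ∃ i, (ofLex p.1).1 ≤ i ∧ v i ≠ 0}) := by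
  by_cases h0 : v = 0
  · subst h0; exact zero_mem _
  · obtain ⟨m, hm, hmi⟩ := exists_last_ne_zero h0
    refine Submodule.span_mono (Set.image_mono ?_) (S.mem_span_syzygies_of_le m v hv hmi)
    exact fun _ hp => ⟨m, hp, hm⟩

theorem ker_toMap :
    LinearMap.ker S.toMap = Submodule.span (MvPolynomial σ K) (Set.range S.syzygies) := by
  apply le_antisymm
  · intro v hv
    exact Submodule.span_mono (Set.image_subset_range _ _) (S.mem_span_syzygies v hv)
  · rw [Submodule.span_le]
    rintro _ ⟨p, rfl⟩
    exact S.toMap_syzygy _ _ _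

theorem smul_syzygies_mem_iff (p : S.SyzygyIndex) (g : MvPolynomial σ K) :
    g • S.syzygies p ∈ Submodule.span (MvPolynomial σ K) (S.syzygies '' Set.Iio p) ↔
      g ∈ Ideal.span (X '' {z | z ∈ S.vars (ofLex p.1).1 ∧ z < (ofLex p.1).2}) := by
  obtain ⟨⟨b, z⟩, hz⟩ := p
  change z ∈ S.vars b at hz
  change g • S.syzygy b z hz ∈ _ ↔ g ∈ Ideal.span (X '' {y | y ∈ S.vars b ∧ y < z})
  constructor
  · intro h
    -- Look at coordinate b: an earlier syzygy has entry 0 there, or a variable y < z of `vars b`.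
    have h1 : Submodule.span (MvPolynomial σ K) (S.syzygies '' Set.Iio ⟨toLex (b, z), hz⟩) ≤
        Submodule.comap (LinearMap.proj b : (S.index → MvPolynomial σ K) →ₗ[MvPolynomial σ K] _)
          (Ideal.span (X '' {y | y ∈ S.vars b ∧ y < z})) := by
      rw [Submodule.span_le]
      rintro _ ⟨⟨⟨c, y⟩, hy⟩, hlt, rfl⟩
      change y ∈ S.vars c at hy
      change S.syzygy c y hy b ∈ Ideal.span _
      rcases (Prod.Lex.toLex_lt_toLex).1 (show toLex (c, y) < toLex (b, z) from hlt) with h | h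
      · rw [S.syzygy_of_lt c y hy b h]; exact zero_mem _
      · obtain ⟨h1, h2⟩ := h
        dsimp only at h1 h2
        subst h1
        rw [S.syzygy_self]
        exact Ideal.subset_span ⟨y, ⟨hy, h2⟩, rfl⟩
    have h2 : g * X z ∈ Ideal.span (X '' {y | y ∈ S.vars b ∧ y < z}) := by
      have := h1 h
      rwa [Submodule.mem_comap, map_smul, LinearMap.proj_apply, S.syzygy_self] at this
    -- The factor `X z` cancels because z is not among the variables y < z.
    rw [mem_ideal_span_X_image] at h2 ⊢
    intro m hm
    obtain ⟨y, hy, hym⟩ := h2 (m + Finsupp.single z 1) (by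
      rw [mem_support_iff, coeff_mul_X]; exact mem_support_iff.1 hm)
    refine ⟨y, hy, ?_⟩
    simpa [Finsupp.single_eq_of_ne hy.2.ne] using hym
  · intro hg
    induction hg using Submodule.span_induction with
    | mem x hx =>
      obtain ⟨y, ⟨hy, hyz⟩, rfl⟩ := hx
      have h1 : (X z : MvPolynomial σ K) • S.syzygy b y hy ∈
          Submodule.span (MvPolynomial σ K) (S.syzygies '' Set.Iio ⟨toLex (b, z), hz⟩) :=
        Submodule.smul_mem _ _ (Submodule.subset_span ⟨⟨toLex (b, y), hy⟩,
          Prod.Lex.toLex_lt_toLex.2 (Or.inr ⟨rfl, hyz⟩), rfl⟩)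
      -- In `X y • syzygy b z - X z • syzygy b y` the entries at b cancel, so this syzygy is
      -- supported before b and needs only pairs with first component below b.
      rw [← sub_add_cancel ((X y : MvPolynomial σ K) • S.syzygy b z hz)
        ((X z : MvPolynomial σ K) • S.syzygy b y hy)]
      refine add_mem (Submodule.span_mono (Set.image_mono ?_) (S.mem_span_syzygies _ ?_)) h1
      · rintro ⟨⟨c, x⟩, hx⟩ ⟨i, hci, hi⟩
        change c ≤ i at hci
        refine Prod.Lex.toLex_lt_toLex.2 (Or.inl (hci.trans_lt ?_))
        by_contra hbi
        refine hi ?_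
        rcases (not_lt.1 hbi).eq_or_lt with h | h
        · change b = i at h
          subst h
          simp [S.syzygy_self, mul_comm]
        · simp [S.syzygy_of_lt b _ _ i h]
      · rw [map_sub, map_smul, map_smul, toMap_syzygy, toMap_syzygy, smul_zero, smul_zero, sub_zero]
    | zero => rw [zero_smul]; exact zero_mem _
    | add x y _ _ hx hy => rw [add_smul]; exact add_mem hx hy
    | smul a x _ hx => rw [smul_assoc]; exact Submodule.smul_mem _ _ hx

variable [Finite σ]

/-- The linear syzygies of a family with linear quotients again have linear quotients. -/
noncomputable def next : LinearQuotients σ K where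
  coord := S.index
  index := S.SyzygyIndex
  fintypeIndex :=
    haveI : Finite (S.index ×ₗ σ) := inferInstanceAs (Finite (S.index × σ))
    Fintype.ofFinite _
  u := S.syzygies
  deg := 1
  isHomogeneous _ := S.syzygy_isHomogeneous _ _ _
  vars p := {z | z ∈ S.vars (ofLex p.1).1 ∧ z < (ofLex p.1).2}
  colon := S.smul_syzygies_mem_iff

/-- The iterated syzygy families. -/
noncomputable def iter : ℕ → LinearQuotients σ K
  | 0 => S
  | i + 1 => (iter i).next

theorem range_toMap_next : LinearMap.range S.next.toMap = LinearMap.ker S.toMap := by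
  rw [ker_toMap]
  exact Fintype.range_linearCombination _ _

end LinearQuotients

/-! ### Grading, minimality and the linear resolution -/

theorem IsHomogeneousOfDegree.zero {σ K : Type*} [CommSemiring K] (z : ℤ) :
    IsHomogeneousOfDegree (0 : MvPolynomial σ K) z := by
  simp [IsHomogeneousOfDegree]

theorem IsHomogeneousOfDegree.add {σ K : Type*} [CommSemiring K] {p q : MvPolynomial σ K} {z : ℤ}
    (hp : IsHomogeneousOfDegree p z) (hq : IsHomogeneousOfDegree q z) :
    IsHomogeneousOfDegree (p + q) z := by
  classical
  intro m hm
  rcases Finset.mem_union.1 (support_add hm) with h | h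
  exacts [hp m h, hq m h]

theorem IsHomogeneousOfDegree.sum {σ K ι : Type*} [CommSemiring K] {z : ℤ} (s : Finset ι)
    (p : ι → MvPolynomial σ K) (hp : ∀ i ∈ s, IsHomogeneousOfDegree (p i) z) :
    IsHomogeneousOfDegree (∑ i ∈ s, p i) z :=
  Finset.sum_induction p (IsHomogeneousOfDegree · z) (fun _ _ => IsHomogeneousOfDegree.add)
    (IsHomogeneousOfDegree.zero z) hp

theorem IsHomogeneousOfDegree.mul {σ K : Type*} [CommSemiring K] {p q : MvPolynomial σ K} {z : ℤ}
    {e : ℕ} (hp : IsHomogeneousOfDegree p z) (hq : q.IsHomogeneous e) :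
    IsHomogeneousOfDegree (p * q) (z + e) := by
  classical
  intro m hm
  obtain ⟨a, ha, b, hb, rfl⟩ := Finset.mem_add.1 (support_mul p q hm)
  have h1 := hp a ha
  have h2 : b.degree = e := by
    rw [Finsupp.degree_eq_weight_one]; exact hq (mem_support_iff.1 hb)
  rw [map_add]
  push_cast
  omega

/-- A vector whose coordinates lie in an ideal `J` lies in `J` times the free module. -/
theorem mem_smul_top_of_forall_mem {R ι : Type*} [CommRing R] [Finite ι] (J : Ideal R) (v : ι → R)
    (hv : ∀ i, v i ∈ J) : v ∈ J • (⊤ : Submodule R (ι → R)) := by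
  classical
  have := Fintype.ofFinite ι
  rw [pi_eq_sum_univ v]
  exact sum_mem fun i _ => Submodule.smul_mem_smul (hv i) trivial

theorem mem_idealOfVars_of_isHomogeneous_one {σ K : Type*} [CommSemiring K] {p : MvPolynomial σ K}
    (hp : p.IsHomogeneous 1) : p ∈ idealOfVars σ K := by
  rw [idealOfVars, ← Set.image_univ, mem_ideal_span_X_image]
  intro m hm
  have h : m.degree = 1 := by
    rw [Finsupp.degree_eq_weight_one]; exact hp (mem_support_iff.1 hm)
  by_contra! hcon
  have h0 : m = 0 := Finsupp.ext fun i => hcon i (Set.mem_univ i)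
  simp [h0] at h

namespace LinearQuotients

variable {σ : Type} {K : Type*} [Field K]

theorem isHomogeneousOfDegree_toMap (S : LinearQuotients σ K) {v : S.index → MvPolynomial σ K}
    {z : ℤ} (hv : ∀ b, IsHomogeneousOfDegree (v b) z) (a : S.coord) :
    IsHomogeneousOfDegree (S.toMap v a) (z + S.deg) := by
  rw [toMap_apply, Finset.sum_apply]
  exact IsHomogeneousOfDegree.sum _ _ fun b _ => (hv b).mul (S.isHomogeneous b a)

section

variable [LinearOrder σ] [Finite σ] (S : LinearQuotients σ K)

/-- The map from the free module on the linear syzygies onto the syzygy module. -/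
noncomputable def syzygyMap : (S.next.index → MvPolynomial σ K) →ₗ[MvPolynomial σ K]
    (S.index → MvPolynomial σ K) :=
  S.next.toMap

theorem exact_syzygyMap_toMap : Function.Exact S.syzygyMap S.toMap :=
  LinearMap.exact_iff.2 S.range_toMap_next.symm

theorem exact_syzygyMap_next : Function.Exact S.next.syzygyMap S.syzygyMap :=
  S.next.exact_syzygyMap_toMap

theorem isHomogeneousOfDegree_syzygyMap {v : S.next.index → MvPolynomial σ K} {z : ℤ}
    (hv : ∀ b, IsHomogeneousOfDegree (v b) z) (a : S.index) :
    IsHomogeneousOfDegree (S.syzygyMap v a) (z + 1) :=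
  S.next.isHomogeneousOfDegree_toMap hv a

theorem range_syzygyMap_le : LinearMap.range S.syzygyMap ≤
    idealOfVars σ K • (⊤ : Submodule (MvPolynomial σ K) (S.index → MvPolynomial σ K)) := by
  rintro _ ⟨v, rfl⟩
  refine mem_smul_top_of_forall_mem _ _ fun a => ?_
  have h : S.syzygyMap v a = ∑ b, v b * S.next.u b a :=
    (congrFun (S.next.toMap_apply v) a).trans (Finset.sum_apply _ _ _)
  rw [h]
  exact sum_mem fun b _ => Ideal.mul_mem_left _ _
    (mem_idealOfVars_of_isHomogeneous_one (S.next.isHomogeneous b a))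

end

/-- An ideal generated by a family of forms of degree `d` with linear quotients has a `d`-linear
resolution. -/
theorem hasLinearResolution [Finite σ] {B : Type} [Fintype B] [LinearOrder B] (d : ℕ)
    (w : B → MvPolynomial σ K) (hw : ∀ b, (w b).IsHomogeneous d) (Z : B → Set σ)
    (hZ : ∀ b g, g * w b ∈ Ideal.span (w '' Set.Iio b) ↔ g ∈ Ideal.span (X '' Z b)) :
    HasLinearResolution (Ideal.span (Set.range w)) d := by
  -- Any order of the variables will do; it only serves to order the syzygies.
  let _ : LinearOrder σ := IsWellOrder.linearOrder WellOrderingRel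
  -- Ring elements become vectors of length one, so that the generators have the same form as the
  -- later syzygies.
  let e : MvPolynomial σ K ≃ₗ[MvPolynomial σ K] (Unit → MvPolynomial σ K) :=
    (LinearEquiv.funUnique Unit (MvPolynomial σ K) (MvPolynomial σ K)).symm
  let S : LinearQuotients σ K :=
    { coord := Unit
      index := B
      u := fun b => e (w b)
      deg := d
      isHomogeneous := fun b _ => hw b
      vars := Z
      colon := fun b g => by
        rw [← hZ, ← map_smul, ← Function.comp_def e w, Set.image_comp, ← LinearEquiv.coe_coe,
          ← Submodule.map_span, LinearEquiv.coe_coe, Submodule.mem_map_equiv,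
          LinearEquiv.symm_apply_apply]
        rfl }
  let ε₀ := Fintype.linearCombination (MvPolynomial σ K) w
  have hε₀ : LinearMap.range ε₀ = Ideal.span (Set.range w) := Fintype.range_linearCombination _ _
  have hS : ∀ v, S.toMap v = e (ε₀ v) := fun v => by
    rw [toMap_apply]
    change _ = e (Fintype.linearCombination _ w v)
    rw [Fintype.linearCombination_apply, map_sum]
    simp only [map_smul]
    rfl
  refine ⟨{
    basis := fun i => (S.iter i).index
    -- The generators have degree d, and each syzygy step has linear entries and adds 1.
    shift := fun i _ => i + d
    d := fun i => (S.iter i).syzygyMap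
    ε := ε₀.codRestrict (Ideal.span (Set.range w)) fun v => hε₀ ▸ LinearMap.mem_range_self ε₀ v
    ε_surjective := ?_
    exact_zero := ?_
    exact_succ := ?_
    ε_graded := ?_
    d_graded := ?_
    minimal := ?_ }, ?_⟩
  · rintro ⟨x, hx⟩
    rw [← hε₀] at hx
    obtain ⟨v, rfl⟩ := hx
    exact ⟨v, rfl⟩
  · refine fun v => Iff.trans ?_ (S.exact_syzygyMap_toMap v)
    rw [hS v, LinearEquiv.map_eq_zero_iff]
    exact Subtype.ext_iff
  · exact fun i => (S.iter i).exact_syzygyMap_next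
  · intro v k hv
    have h0 : S.toMap v () = ε₀ v := congrFun (hS v) ()
    have h : IsHomogeneousOfDegree (ε₀ v) (k - ((0 : ℕ) + d) + d) :=
      h0 ▸ S.isHomogeneousOfDegree_toMap hv ()
    rw [Nat.cast_zero, zero_add, sub_add_cancel] at h
    exact h
  · intro i v k hv a
    have h := (S.iter i).isHomogeneousOfDegree_syzygyMap hv a
    rw [show k - (((i + 1 : ℕ) : ℤ) + d) + 1 = k - (i + d) by push_cast; ring] at h
    exact h
  · exact fun i => (S.iter i).range_syzygyMap_le
  · intro i j hj
    have : IsEmpty {b : (S.iter i).index // (i + d : ℤ) = j} := ⟨fun b => hj b.2.symm⟩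
    exact Nat.card_of_isEmpty

end LinearQuotients

/-! ### Monomial families and the exchange step -/

/-- A criterion for linear quotients of a finite ordered family of monomials of degree `d`. -/
theorem hasLinearResolution_of_monomials {σ : Type} [Finite σ] {K : Type*} [Field K] {B : Type}
    [Finite B] [LinearOrder B] (d : ℕ) (w : B → σ →₀ ℕ) (hw : ∀ b, (w b).degree = d)
    (h : ∀ i j, i < j → ∃ z, w j z < w i z ∧ ∃ k < j, w k ≤ w j + Finsupp.single z 1) :
    HasLinearResolution
      (Ideal.span (Set.range fun b => monomial (w b) (1 : K)) : Ideal (MvPolynomial σ K)) d := by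
  have := Fintype.ofFinite B
  refine LinearQuotients.hasLinearResolution d _ (fun b => isHomogeneous_monomial _ (hw b))
    (fun j => {z | ∃ k < j, w k ≤ w j + Finsupp.single z 1}) fun j g => ?_
  rw [mem_ideal_span_X_image]
  have himage : (fun b => monomial (w b) (1 : K)) '' Set.Iio j =
      (fun a => monomial a (1 : K)) '' (w '' Set.Iio j) := by rw [Set.image_image]
  rw [himage, mem_ideal_span_monomial_image]
  constructor
  · intro hg m hm
    -- If `w i` divides `m + w j` and `w j z < w i z`, then z occurs in m.
    obtain ⟨_, ⟨i, hi, rfl⟩, him⟩ := hg (m + w j) (by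
      rw [mem_support_iff, coeff_mul_monomial, mul_one]; exact mem_support_iff.1 hm)
    obtain ⟨z, hz, hk⟩ := h i j hi
    refine ⟨z, hk, ?_⟩
    have := him z
    rw [Finsupp.add_apply] at this
    omega
  · intro hg m hm
    rw [mem_support_iff, coeff_mul_monomial'] at hm
    split_ifs at hm with hle
    · rw [mul_one] at hm
      obtain ⟨z, ⟨k, hk, hkz⟩, hz⟩ := hg _ (mem_support_iff.2 hm)
      refine ⟨w k, ⟨k, hk, rfl⟩, hkz.trans ?_⟩
      rw [← tsub_add_cancel_of_le hle, add_comm]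
      gcongr
      rw [Finsupp.single_le_iff]
      omega
    · exact absurd rfl hm

theorem Finsupp.exists_lt_of_degree_le_of_ne {ι : Type*} {a b : ι →₀ ℕ} (hd : b.degree ≤ a.degree)
    (hne : a ≠ b) : ∃ i, b i < a i := by
  by_contra! h
  have hab : a + (b - a) = b := add_tsub_cancel_of_le h
  have hdeg : (b - a).degree = 0 := by
    have := congrArg Finsupp.degree hab
    rw [map_add] at this
    omega
  rw [Finsupp.degree_eq_zero_iff] at hdeg
  exact hne (by rw [← hab, hdeg, add_zero])

theorem Finsupp.degree_sub_single_add_one {ι : Type*} {f : ι →₀ ℕ} {k : ι} (hk : f k ≠ 0) :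
    (f - Finsupp.single k 1).degree + 1 = f.degree := by
  have h : f - Finsupp.single k 1 + Finsupp.single k 1 = f :=
    tsub_add_cancel_of_le (Finsupp.single_le_iff.2 (Nat.one_le_iff_ne_zero.2 hk))
  conv_rhs => rw [← h, map_add, Finsupp.degree_single]

/-- The exchange step for the monomials of degree `d` with exponents bounded by `v`, ordered
lexicographically. -/
theorem exists_lex_exchange {n : ℕ} {v : Fin n → ℕ} {a b : Fin n →₀ ℕ} (hd : a.degree = b.degree)
    (ha : ∀ i, a i ≤ v i) (hb : ∀ i, b i ≤ v i) (hlt : toLex b < toLex a) :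
    ∃ p, b p < a p ∧ ∃ c : Fin n →₀ ℕ, c.degree = b.degree ∧ (∀ i, c i ≤ v i) ∧
      toLex b < toLex c ∧ c ≤ b + Finsupp.single p 1 := by
  obtain ⟨p, hp, hpl⟩ := Finsupp.Lex.lt_iff.1 hlt
  change ∀ j, j < p → b j = a j at hp
  change b p < a p at hpl
  -- The degrees agree, so the excess of a at p, the first difference, is compensated at some q with
  -- `a q < b q`, necessarily after p. Moving one unit of b from q to p gives c.
  obtain ⟨q, hq⟩ := Finsupp.exists_lt_of_degree_le_of_ne hd.le
    (show b ≠ a by rintro rfl; exact lt_irrefl _ hlt)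
  have hpq : p < q := by
    rcases lt_trichotomy p q with h | h | h
    · exact h
    · subst h; omega
    · have := hp q h; omega
  refine ⟨p, hpl, b + Finsupp.single p 1 - Finsupp.single q 1, ?_, fun i => ?_, ?_, tsub_le_self⟩
  · have h := Finsupp.degree_sub_single_add_one (f := b + Finsupp.single p 1) (k := q) (by
      rw [Finsupp.add_apply]; omega)
    rw [map_add, Finsupp.degree_single] at h
    omega
  · rw [Finsupp.tsub_apply, Finsupp.add_apply]
    by_cases hi : i = p
    · subst hi
      have := ha i
      rw [Finsupp.single_eq_same]
      omega
    · have := hb i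
      rw [Finsupp.single_eq_of_ne hi]
      omega
  · refine Finsupp.Lex.lt_iff.2 ⟨p, fun j hj => ?_, ?_⟩
    · change b j = (b + Finsupp.single p 1 - Finsupp.single q 1 : Fin n →₀ ℕ) j
      rw [Finsupp.tsub_apply, Finsupp.add_apply, Finsupp.single_eq_of_ne hj.ne,
        Finsupp.single_eq_of_ne (hj.trans hpq).ne]
      omega
    · change b p < (b + Finsupp.single p 1 - Finsupp.single q 1 : Fin n →₀ ℕ) p
      rw [Finsupp.tsub_apply, Finsupp.add_apply, Finsupp.single_eq_same,
        Finsupp.single_eq_of_ne hpq.ne]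
      omega

/-! ### Linear quotients of the linearization -/

/-- The exponent vectors of degree `d` bounded by `v`. -/
def BoundedExponent (n d : ℕ) (v : Fin n → ℕ) : Type :=
  {a : Fin n →₀ ℕ // a.degree = d ∧ ∀ i, a i ≤ v i}

instance (n d : ℕ) (v : Fin n → ℕ) : Finite (BoundedExponent n d v) :=
  ((Set.finite_Iic (Finsupp.equivFunOnFinite.symm v)).subset fun _ ha i => ha.2 i).to_subtype

/-- The decreasing lexicographic order. -/
noncomputable instance (n d : ℕ) (v : Fin n → ℕ) :
    LinearOrder (BoundedExponent n d v) :=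
  LinearOrder.lift' (fun a => OrderDual.toDual (toLex a.1)) fun _ _ h => Subtype.ext h

/-- The exponent vectors of the generators of a linearization: the monomials `x ^ a` of degree `d`
bounded by `v`, and the monomials `(f / x_k) y_f`. -/
noncomputable def linearizationExponent {n : ℕ} {G : Type} (d : ℕ) (v : Fin n → ℕ)
    (f : G → Fin n →₀ ℕ) :
    BoundedExponent n d v ⊕ {p : G × Fin n // f p.1 p.2 ≠ 0} → (Fin n ⊕ G) →₀ ℕ
  | .inl a => a.1.mapDomain Sum.inl
  | .inr p => (f p.1.1 - Finsupp.single p.1.2 1).mapDomain Sum.inl + Finsupp.single (Sum.inr p.1.1) 1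

/-- A vector bounded by `v` that lies strictly below some vector bounded by `v` in
the coordinate `i` can be raised there by one. -/
theorem add_single_le {n : ℕ} {v : Fin n → ℕ} {h c : Fin n →₀ ℕ} (hh : ∀ i, h i ≤ v i)
    (hc : ∀ i, c i ≤ v i) {i : Fin n} (hi : h i < c i) (j : Fin n) :
    (h + Finsupp.single i 1 : Fin n →₀ ℕ) j ≤ v j := by
  rw [Finsupp.add_apply]
  by_cases hj : j = i
  · subst hj
    have := hc j
    rw [Finsupp.single_eq_same]
    omega
  · rw [Finsupp.single_eq_of_ne hj]
    exact hh j

theorem hasLinearResolution_linearization {n : ℕ} {G : Type} [Finite G] {K : Type*} [Field K]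
    (d : ℕ) (v : Fin n → ℕ) (f : G → Fin n →₀ ℕ) (hdeg : ∀ g, (f g).degree = d)
    (hle : ∀ g i, f g i ≤ v i) :
    HasLinearResolution (Ideal.span (Set.range fun b =>
      monomial (linearizationExponent d v f b) (1 : K))) d := by
  have hinl := Sum.inl_injective (α := Fin n) (β := G)
  have hxx : ∀ (a : Fin n →₀ ℕ) i, a.mapDomain (Sum.inl : _ → Fin n ⊕ G) (Sum.inl i) = a i :=
    fun a i => Finsupp.mapDomain_apply hinl a i
  have hxy : ∀ (a : Fin n →₀ ℕ) g, a.mapDomain (Sum.inl : _ → Fin n ⊕ G) (Sum.inr g) = 0 :=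
    fun a g => Finsupp.mapDomain_of_notMem_range a _ (by simp)
  let _ : LinearOrder {p : G × Fin n // f p.1 p.2 ≠ 0} := IsWellOrder.linearOrder WellOrderingRel
  let B := BoundedExponent n d v ⊕ₗ {p : G × Fin n // f p.1 p.2 ≠ 0}
  have : Finite B := inferInstanceAs (Finite (BoundedExponent n d v ⊕ _))
  let w : B → (Fin n ⊕ G) →₀ ℕ := fun b => linearizationExponent d v f (ofLex b)
  -- the generators `x ^ c` are reached from `(f / x_k) y_f` by one variable
  have key : ∀ (p : {p : G × Fin n // f p.1 p.2 ≠ 0}) (c : Fin n →₀ ℕ) (i : Fin n),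
      (∀ j, c j ≤ v j) → (f p.1.1 - Finsupp.single p.1.2 1 : Fin n →₀ ℕ) i < c i →
      ∃ k < (toLex (Sum.inr p) : B), w k ≤ w (toLex (Sum.inr p)) + Finsupp.single (Sum.inl i) 1 := by
    intro p c i hc hi
    have hb : ∀ j, (f p.1.1 - Finsupp.single p.1.2 1 : Fin n →₀ ℕ) j ≤ v j := fun j =>
      (tsub_le_self (a := f p.1.1) (b := Finsupp.single p.1.2 1) j).trans (hle _ j)
    refine ⟨toLex (Sum.inl ⟨f p.1.1 - Finsupp.single p.1.2 1 + Finsupp.single i 1, ?_,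
      add_single_le hb hc hi⟩), Sum.Lex.inl_lt_inr _ _, ?_⟩
    · rw [map_add, Finsupp.degree_single, Finsupp.degree_sub_single_add_one p.2, hdeg]
    · change Finsupp.mapDomain Sum.inl _ ≤ Finsupp.mapDomain Sum.inl _ + _ + _
      rw [Finsupp.mapDomain_add, Finsupp.mapDomain_single, add_right_comm]
      exact le_self_add
  have main : HasLinearResolution (Ideal.span (Set.range fun b => monomial (w b) (1 : K))) d := by
    refine hasLinearResolution_of_monomials d w ?_ ?_
    · rintro (a | p)
      · exact (Finsupp.degree_mapDomain _ _).trans a.2.1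
      · change (Finsupp.mapDomain Sum.inl _ + Finsupp.single _ 1).degree = d
        rw [map_add, Finsupp.degree_mapDomain, Finsupp.degree_single,
          Finsupp.degree_sub_single_add_one p.2, hdeg]
    · rintro (a | p) (b | q) hlt
      · have hab : a < b := Sum.Lex.inl_lt_inl_iff.1 hlt
        obtain ⟨z, hz, c, hcd, hcv, hbc, hcb⟩ :=
          exists_lex_exchange (a.2.1.trans b.2.1.symm) a.2.2 b.2.2 hab
        refine ⟨Sum.inl z, ?_, toLex (Sum.inl ⟨c, hcd.trans b.2.1, hcv⟩),
          Sum.Lex.inl_lt_inl_iff.2 hbc, ?_⟩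
        · change Finsupp.mapDomain Sum.inl b.1 _ < Finsupp.mapDomain Sum.inl a.1 _
          rwa [hxx, hxx]
        · change Finsupp.mapDomain Sum.inl c ≤ Finsupp.mapDomain Sum.inl b.1 + _
          rw [← Finsupp.mapDomain_single (f := (Sum.inl : _ → Fin n ⊕ G)), ← Finsupp.mapDomain_add]
          exact Finsupp.mapDomain_mono hcb
      -- The quotient f/x_k has degree d - 1 < d, so some exponent of a exceeds the one in it.
      · have hd := Finsupp.degree_sub_single_add_one q.2
        rw [hdeg] at hd
        obtain ⟨i, hi⟩ := Finsupp.exists_lt_of_degree_le_of_ne (a := a.1)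
          (b := f q.1.1 - Finsupp.single q.1.2 1) (by rw [a.2.1]; omega) (by
            intro h
            rw [← h, a.2.1] at hd
            omega)
        refine ⟨Sum.inl i, ?_, key q a.1 i a.2.2 hi⟩
        change (Finsupp.mapDomain Sum.inl _ + Finsupp.single _ 1 : _ →₀ ℕ) _ <
          Finsupp.mapDomain Sum.inl a.1 _
        rw [Finsupp.add_apply, hxx, hxx, Finsupp.single_eq_of_ne Sum.inl_ne_inr, add_zero]
        exact hi
      · exact absurd hlt Sum.Lex.not_inr_lt_inl
      · by_cases heq : f p.1.1 - Finsupp.single p.1.2 1 = f q.1.1 - Finsupp.single q.1.2 1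
        -- For a fixed f, the quotient f/x_k determines k; distinct pairs with equal quotients thus
        -- have different f, and the y-variable of p separates them.
        · have hne : p.1.1 ≠ q.1.1 := by
            intro h
            have h2 : p.1.2 ≠ q.1.2 := fun h2 =>
              hlt.ne (congrArg (fun x => toLex (Sum.inr x)) (Subtype.ext (Prod.ext h h2)))
            have h3 := DFunLike.congr_fun heq q.1.2
            have h4 := q.2
            rw [h, Finsupp.tsub_apply, Finsupp.tsub_apply, Finsupp.single_eq_same,
              Finsupp.single_eq_of_ne h2.symm] at h3
            omega
          refine ⟨Sum.inr p.1.1, ?_, toLex (Sum.inr p), hlt, ?_⟩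
          · change (Finsupp.mapDomain Sum.inl _ + Finsupp.single _ 1 : _ →₀ ℕ) _ <
              (Finsupp.mapDomain Sum.inl _ + Finsupp.single _ 1 : _ →₀ ℕ) _
            rw [Finsupp.add_apply, Finsupp.add_apply, hxy, hxy, Finsupp.single_eq_same,
              Finsupp.single_eq_of_ne (by simpa using hne)]
            omega
          · change Finsupp.mapDomain Sum.inl _ + _ ≤ Finsupp.mapDomain Sum.inl _ + _ + _
            rw [heq, add_right_comm]
            exact le_self_add
        -- Distinct quotients of the same degree d - 1: some exponent is larger in that of p, and
        -- the bound on p leaves room to raise that of q.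
        · have hp := Finsupp.degree_sub_single_add_one p.2
          have hq := Finsupp.degree_sub_single_add_one q.2
          rw [hdeg] at hp hq
          obtain ⟨i, hi⟩ := Finsupp.exists_lt_of_degree_le_of_ne (by omega) heq
          refine ⟨Sum.inl i, ?_, key q _ i (fun j => (tsub_le_self (a := f p.1.1)
            (b := Finsupp.single p.1.2 1) j).trans (hle _ j)) hi⟩
          change (Finsupp.mapDomain Sum.inl _ + Finsupp.single _ 1 : _ →₀ ℕ) _ <
            (Finsupp.mapDomain Sum.inl _ + Finsupp.single _ 1 : _ →₀ ℕ) _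
          rw [Finsupp.add_apply, Finsupp.add_apply, hxx, hxx,
            Finsupp.single_eq_of_ne Sum.inl_ne_inr, Finsupp.single_eq_of_ne Sum.inl_ne_inr]
          exact hi
  exact main

theorem completePart_sup_lastPart_eq_span {n : ℕ} {K : Type*} [Field K]
    (I : Ideal (MvPolynomial (Fin n) K)) (d : ℕ) (v : Fin n → ℕ) :
    completePart I d v ⊔ lastPart I = Ideal.span (Set.range fun b => monomial
      (linearizationExponent d v (Subtype.val : minGens I → Fin n →₀ ℕ) b) (1 : K)) := by
  rw [completePart, lastPart, ← Ideal.span_union]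
  congr 1
  ext p
  simp only [Set.mem_union, Set.mem_ofPred_eq, Set.mem_range, Sum.exists, linearizationExponent]
  refine or_congr ⟨?_, ?_⟩ ⟨?_, ?_⟩
  · rintro ⟨a, h1, h2, rfl⟩
    exact ⟨⟨a, h1, h2⟩, (rename_monomial _ _ _).symm⟩
  · rintro ⟨a, rfl⟩
    exact ⟨a.1, a.2.1, a.2.2, (rename_monomial _ _ _).symm⟩
  · rintro ⟨f, k, hk, rfl⟩
    refine ⟨⟨(f, k), hk⟩, ?_⟩
    rw [rename_monomial, X, monomial_mul, one_mul]
  · rintro ⟨p, rfl⟩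
    refine ⟨p.1.1, p.1.2, p.2, ?_⟩
    rw [rename_monomial, X, monomial_mul, one_mul]

/-! ### The two exponent bounds -/

theorem le_maxExp {n : ℕ} {K : Type*} [Field K] {I : Ideal (MvPolynomial (Fin n) K)} {d : ℕ}
    (hI : IsEquigenerated I d) (f : minGens I) (i : Fin n) : f.1 i ≤ maxExp I i := by
  -- A supremum in ℕ is 0 for an unbounded family, so a bound is required; exponents are at most the
  -- degree d.
  refine le_ciSup (f := fun f : minGens I => f.1 i) ⟨d, ?_⟩ f
  rintro _ ⟨g, rfl⟩
  exact (Finsupp.le_degree i g.1).trans (hI g.1 g.2).le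

theorem maxExp_le_maxExpAll {n : ℕ} {K : Type*} [Field K] (I : Ideal (MvPolynomial (Fin n) K))
    (i : Fin n) : maxExp I i ≤ maxExpAll I :=
  le_ciSup (Set.finite_range _).bddAbove i

theorem hasLinearResolution_completePart_sup_lastPart {n : ℕ} {K : Type*} [Field K]
    {I : Ideal (MvPolynomial (Fin n) K)} {d : ℕ} (hI : IsEquigenerated I d) (v : Fin n → ℕ)
    (hv : ∀ i, maxExp I i ≤ v i) : HasLinearResolution (completePart I d v ⊔ lastPart I) d := by
  have hle : ∀ (f : minGens I) i, f.1 i ≤ v i := fun f i => (le_maxExp hI f i).trans (hv i)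
  -- The exponent vectors of the minimal generators lie in the finite box below v.
  have : Finite (minGens I) := ((Set.finite_Iic (Finsupp.equivFunOnFinite.symm v)).subset
    fun f hf i => hle ⟨f, hf⟩ i).to_subtype
  rw [completePart_sup_lastPart_eq_span]
  exact hasLinearResolution_linearization d v _ (fun f => hI f.1 f.2) hle

theorem corollary3p4 {K : Type*} [Field K] {n : ℕ} (I : Ideal (MvPolynomial (Fin n) K)) (d : ℕ)
    (hmon : IsMonomialIdeal I) (hI : IsEquigenerated I d) :
    HasLinearResolution (Lin I d) d ∧ HasLinearResolution (LINStar I d) d :=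
  ⟨hasLinearResolution_completePart_sup_lastPart hI _ fun _ => le_rfl,
    hasLinearResolution_completePart_sup_lastPart hI _ (maxExp_le_maxExpAll I)⟩
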